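/- Work in the intuitionistic predicate language with countably many individual variables, countably many predicate letters of each arity, $\bot$, $\wedge$, $\vee$, $\to$, $\forall$, $\exists$ (no equality, constants or function symbols). An \emph{augmented frame} over a non-empty partially ordered set $F=\langle W,R\rangle$ assigns to every $w\in W$ a non-empty domain $D_w$ such that $wRw'$ implies $D_w\subseteq D_{w'}$; it has \emph{constant domains} if $wRw'$ implies $D_w=D_{w'}$. A \emph{model} on it assigns to every $w$ and every $n$-ary predicate letter $P$ an $n$-ary relation $I(w,P)$ on $D_w$ such that $wRw'$ implies $I(w,P)\subseteq I(w',P)$. Truth at a world is defined by the usual Kripke clauses for intuitionistic logic (with $\to$ and $\forall$ evaluated at all $R$-accessible worlds $v$, the quantifier $\forall$ at $v$ and the quantifier $\exists$ at $w$ ranging over $D_v$ and $D_w$ respectively). A formula is valid on an augmented frame if in every model on it the formula is true at every world $w$ under every assignment of elements of $D_w$ to its free variables. Let $\mathrm{QSIL}_e F$ (respectively $\mathrm{QSIL}_c F$) be the set of formulas valid on all augmented frames over $F$ (respectively all augmented frames over $F$ with constant domains). For a set $L$ of formulas, let $L^+$ be the set of formulas in $L$ in which $\bot$ does not occur. \textbf{Corollary.}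 Let $F$ be one of $\langle\mathbb Z,\leqslant\rangle$, $\langle\mathbb R,\leqslant\rangle$, or $\langle\alpha,\subseteq\rangle$, where $\alpha$ is an infinite ordinal. Then both $(\mathrm{QSIL}_e F)^+$ and $(\mathrm{QSIL}_c F)^+$ are $\Sigma^0_1$-hard in the language with two individual variables, a single binary predicate letter, and infinitely many unary predicate letters (and no other predicate letters). That is, for each of these sets $L^+$ and every recursively enumerable $A\subseteq\mathbb N$ there is a computable function $f$ from $\mathbb N$ to the formulas of this restricted language such that, for all $n\in\mathbb N$, $n\in A$ if and only if $f(n)\in L^+$. -/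

import Mathlib

/-!
Syntax and Kripke semantics of intuitionistic predicate logic, superintuitionistic predicate logics
of classes of augmented frames, and many-one hardness for the class of recursively enumerable sets.
-/

universe u v

namespace IntPred

/-- Formulas of the intuitionistic predicate language. The individual variables are `x₀, x₁, …`;
`atom n i t` is the atomic formula `P(x_{t 0}, …, x_{t (n-1)})`, where `P` is the `i`-th predicate
letter of arity `n`. -/
inductive Formula : Type
  | bot : Formula
  | atom (n i : ℕ) (t : Fin n → ℕ) : Formula
  | and (φ ψ : Formula) : Formula
  | or (φ ψ : Formula) : Formula
  | imp (φ ψ : Formula) : Formula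
  | all (x : ℕ) (φ : Formula) : Formula
  | ex (x : ℕ) (φ : Formula) : Formula

namespace Formula

/-- The set of free variables of a formula. -/
def freeVars : Formula → Set ℕ
  | bot => ∅
  | atom _ _ t => Set.range t
  | and φ ψ => φ.freeVars ∪ ψ.freeVars
  | or φ ψ => φ.freeVars ∪ ψ.freeVars
  | imp φ ψ => φ.freeVars ∪ ψ.freeVars
  | all x φ => φ.freeVars \ {x}
  | ex x φ => φ.freeVars \ {x}

/-- A formula is positive if `⊥` does not occur in it. -/
def Positive : Formula → Prop
  | bot => False
  | atom _ _ _ => True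
  | and φ ψ => φ.Positive ∧ ψ.Positive
  | or φ ψ => φ.Positive ∧ ψ.Positive
  | imp φ ψ => φ.Positive ∧ ψ.Positive
  | all _ φ => φ.Positive
  | ex _ φ => φ.Positive

/-- The formula belongs to the language with the two individual variables `x₀, x₁` (free or bound),
a single binary predicate letter (the one with index `0`), and the infinitely many unary predicate
letters; no other predicate letter may occur. -/
def InTwoVarLanguage : Formula → Prop
  | bot => True
  | atom n i t => (n = 1 ∨ (n = 2 ∧ i = 0)) ∧ ∀ k, t k < 2
  | and φ ψ => φ.InTwoVarLanguage ∧ ψ.InTwoVarLanguage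
  | or φ ψ => φ.InTwoVarLanguage ∧ ψ.InTwoVarLanguage
  | imp φ ψ => φ.InTwoVarLanguage ∧ ψ.InTwoVarLanguage
  | all x φ => x < 2 ∧ φ.InTwoVarLanguage
  | ex x φ => x < 2 ∧ φ.InTwoVarLanguage

/-! ### Gödel numbering -/

/-- The Gödel number of a formula. -/
def toCode : Formula → ℕ
  | bot => 0
  | atom _ i t => 6 * Nat.pair i (Encodable.encode (List.ofFn t)) + 1
  | and φ ψ => 6 * Nat.pair φ.toCode ψ.toCode + 2
  | or φ ψ => 6 * Nat.pair φ.toCode ψ.toCode + 3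
  | imp φ ψ => 6 * Nat.pair φ.toCode ψ.toCode + 4
  | all x φ => 6 * Nat.pair x φ.toCode + 5
  | ex x φ => 6 * Nat.pair x φ.toCode + 6

/-- The atomic formula given by the index of its predicate letter and its list of arguments. -/
def atomOfList (i : ℕ) (l : List ℕ) : Formula := atom l.length i l.get

theorem atomOfList_ofFn (n i : ℕ) (t : Fin n → ℕ) : atomOfList i (List.ofFn t) = atom n i t := by
  have h : ∀ s : Σ m, (Fin m → ℕ), s = ⟨n, t⟩ → atom s.1 i s.2 = atom n i t := by
    rintro s rfl; rfl
  exact h ⟨_, (List.ofFn t).get⟩ (List.equivSigmaTuple.right_inv ⟨n, t⟩)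

/-- The formula with a given Gödel number. -/
def ofCode : ℕ → Formula
  | 0 => bot
  | n + 1 =>
    have _h₁ : (n / 6).unpair.1 < n + 1 :=
      Nat.lt_succ_of_le ((Nat.unpair_left_le _).trans (Nat.div_le_self _ _))
    have _h₂ : (n / 6).unpair.2 < n + 1 :=
      Nat.lt_succ_of_le ((Nat.unpair_right_le _).trans (Nat.div_le_self _ _))
    match n % 6 with
    | 0 => atomOfList (n / 6).unpair.1 (Denumerable.ofNat (List ℕ) (n / 6).unpair.2)
    | 1 => and (ofCode (n / 6).unpair.1) (ofCode (n / 6).unpair.2)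
    | 2 => or (ofCode (n / 6).unpair.1) (ofCode (n / 6).unpair.2)
    | 3 => imp (ofCode (n / 6).unpair.1) (ofCode (n / 6).unpair.2)
    | 4 => all (n / 6).unpair.1 (ofCode (n / 6).unpair.2)
    | _ => ex (n / 6).unpair.1 (ofCode (n / 6).unpair.2)

theorem ofCode_toCode (φ : Formula) : ofCode φ.toCode = φ := by
  have hd : ∀ k r : ℕ, r < 6 → (6 * k + r) / 6 = k := fun k r h => by omega
  have hm : ∀ k r : ℕ, r < 6 → (6 * k + r) % 6 = r := fun k r h => by omega
  induction φ with
  | bot => simp [toCode, ofCode]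
  | atom n i t =>
    have h := hd (Nat.pair i (Encodable.encode (List.ofFn t))) 0 (by norm_num)
    have h' := hm (Nat.pair i (Encodable.encode (List.ofFn t))) 0 (by norm_num)
    rw [toCode, ofCode]
    simp only [add_zero] at h h'
    simp only [h, h', Nat.unpair_pair, Denumerable.ofNat_encode, atomOfList_ofFn]
  | and φ ψ h₁ h₂ =>
    rw [toCode, ofCode]
    simp only [hd _ 1 (by norm_num), hm _ 1 (by norm_num), Nat.unpair_pair, h₁, h₂]
  | or φ ψ h₁ h₂ =>
    rw [toCode, ofCode]
    simp only [hd _ 2 (by norm_num), hm _ 2 (by norm_num), Nat.unpair_pair, h₁, h₂]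
  | imp φ ψ h₁ h₂ =>
    rw [toCode, ofCode]
    simp only [hd _ 3 (by norm_num), hm _ 3 (by norm_num), Nat.unpair_pair, h₁, h₂]
  | all x φ h₁ =>
    rw [toCode, ofCode]
    simp only [hd _ 4 (by norm_num), hm _ 4 (by norm_num), Nat.unpair_pair, h₁]
  | ex x φ h₁ =>
    rw [toCode, ofCode]
    simp only [hd _ 5 (by norm_num), hm _ 5 (by norm_num), Nat.unpair_pair, h₁]

theorem toCode_ofCode (n : ℕ) : (ofCode n).toCode = n := by
  induction n using Nat.strong_induction_on with
  | _ n ih =>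
    cases n with
    | zero => simp [toCode, ofCode]
    | succ n =>
      have h₁ := ih (n / 6).unpair.1
        (Nat.lt_succ_of_le ((Nat.unpair_left_le _).trans (Nat.div_le_self _ _)))
      have h₂ := ih (n / 6).unpair.2
        (Nat.lt_succ_of_le ((Nat.unpair_right_le _).trans (Nat.div_le_self _ _)))
      have hn := Nat.div_add_mod n 6
      have hlt := Nat.mod_lt n (show 6 > 0 by norm_num)
      rw [ofCode]
      generalize hr : n % 6 = r at hn hlt
      interval_cases r
      · simp only [atomOfList, toCode]
        rw [List.ofFn_get, Denumerable.encode_ofNat, Nat.pair_unpair]; omega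
      all_goals
        simp only [toCode, h₁, h₂, Nat.pair_unpair]
        omega

/-- Gödel numbering is a bijection between formulas and natural numbers. -/
def equivNat : Formula ≃ ℕ where
  toFun := toCode
  invFun := ofCode
  left_inv := ofCode_toCode
  right_inv := toCode_ofCode

/-- Computability of functions with values in formulas refers to the Gödel numbering. -/
instance : Primcodable Formula := Primcodable.ofEquiv ℕ equivNat

end Formula

/-! ### Semantics -/

/-- Intuitionistic Kripke frames: a non-empty set of worlds with a partial order. -/
structure KripkeFrame : Type (u + 1) where
  World : Type u
  nonempty : Nonempty World
  R : World → World → Prop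
  refl : ∀ w, R w w
  trans : ∀ u v w, R u v → R v w → R u w
  antisymm : ∀ u v, R u v → R v u → u = v

/-- The frame `⟨W, ≤⟩` of a non-empty partially ordered set. -/
def KripkeFrame.ofOrder (W : Type u) [PartialOrder W] [hW : Nonempty W] : KripkeFrame.{u} where
  World := W
  nonempty := hW
  R u v := u ≤ v
  refl := le_refl
  trans _ _ _ := le_trans
  antisymm _ _ := le_antisymm

/-- Intuitionistic augmented frames: an intuitionistic Kripke frame, a set `Ind` of individuals and
non-empty domains `D w ⊆ Ind` subject to the expanding domain condition. -/
structure AugFrame : Type (max (u + 1) (v + 1)) where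
  frame : KripkeFrame.{u}
  Ind : Type v
  D : frame.World → Set Ind
  nonempty : ∀ w, (D w).Nonempty
  expanding : ∀ u w, frame.R u w → D u ⊆ D w

/-- The locally constant domain condition. -/
def AugFrame.LocallyConstant (A : AugFrame.{u, v}) : Prop :=
  ∀ u w, A.frame.R u w → A.D u = A.D w

/-- Intuitionistic predicate Kripke models based on an augmented frame: `I w n i` is the
interpretation at `w` of the `i`-th `n`-ary predicate letter. -/
structure Model (A : AugFrame.{u, v}) where
  I : A.frame.World → (n : ℕ) → ℕ → Set (Fin n → A.Ind)
  I_subset : ∀ w n i, ∀ a ∈ I w n i, ∀ k, a k ∈ A.D w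
  hereditary : ∀ w w', A.frame.R w w' → ∀ n i, I w n i ⊆ I w' n i

/-- Truth of a formula at a world of a model under an assignment. -/
def Model.Sat {A : AugFrame.{u, v}} (M : Model A) : A.frame.World → (ℕ → A.Ind) → Formula → Prop
  | _, _, .bot => False
  | w, g, .atom n i t => (fun k => g (t k)) ∈ M.I w n i
  | w, g, .and φ ψ => M.Sat w g φ ∧ M.Sat w g ψ
  | w, g, .or φ ψ => M.Sat w g φ ∨ M.Sat w g ψ
  | w, g, .imp φ ψ => ∀ v, A.frame.R w v → M.Sat v g φ → M.Sat v g ψ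
  | w, g, .all x φ => ∀ v, A.frame.R w v → ∀ a ∈ A.D v, M.Sat v (Function.update g x a) φ
  | w, g, .ex x φ => ∃ a ∈ A.D w, M.Sat w (Function.update g x a) φ

/-- A formula is valid in a model if it is true at every world `w` under every assignment sending
its free variables to `D w`. -/
def Model.Valid {A : AugFrame.{u, v}} (M : Model A) (φ : Formula) : Prop :=
  ∀ (w : A.frame.World) (g : ℕ → A.Ind), (∀ x ∈ φ.freeVars, g x ∈ A.D w) → M.Sat w g φ

/-- Validity of a formula in an augmented frame. -/
def AugFrame.Valid (A : AugFrame.{u, v}) (φ : Formula) : Prop := ∀ M : Model A, M.Valid φ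

/-- The superintuitionistic predicate logic of a class of intuitionistic augmented frames. -/
def QSIL (C : Set AugFrame.{u, v}) : Set Formula := {φ | ∀ A ∈ C, A.Valid φ}

/-- The class of e-augmented frames based on Kripke frames of a class. -/
def augE (C : Set KripkeFrame.{u}) : Set AugFrame.{u, v} := {A | A.frame ∈ C}

/-- The class of c-augmented frames based on Kripke frames of a class. -/
def augC (C : Set KripkeFrame.{u}) : Set AugFrame.{u, v} := {A | A.frame ∈ C ∧ A.LocallyConstant}

/-- The logic of all e-augmented frames over a Kripke frame (with individuals from `Type v`). -/
def QSILe (F : KripkeFrame.{u}) : Set Formula := QSIL (augE.{u, v} {F})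

/-- The logic of all c-augmented frames over a Kripke frame (with individuals from `Type v`). -/
def QSILc (F : KripkeFrame.{u}) : Set Formula := QSIL (augC.{u, v} {F})

/-- The positive fragment of a logic. -/
def positiveFragment (L : Set Formula) : Set Formula := {φ ∈ L | φ.Positive}

/-- `L` is `Σ⁰₁`-hard in the language with two individual variables, a single binary predicate
letter and infinitely many unary predicate letters: every recursively enumerable set of natural
numbers is reducible to `L` by a computable many-one reduction whose values are formulas of that
language. -/
def SigmaOneHardInTwoVarLanguage (L : Set Formula) : Prop :=
  ∀ A : ℕ → Prop, REPred A → ∃ f : ℕ → Formula, Computable f ∧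
    (∀ n, (f n).InTwoVarLanguage) ∧ ∀ n, A n ↔ f n ∈ L

/-- The frame `⟨α, ⊆⟩` of a non-zero ordinal `α`: its worlds are the elements of `α`, i.e. the
ordinals below `α`, and inclusion of ordinals is the order `≤`. -/
def ordinalFrame (α : Ordinal.{u}) (hα : 0 < α) : KripkeFrame.{u + 1} :=
  @KripkeFrame.ofOrder (Set.Iio α) _ ⟨⟨0, hα⟩⟩

end IntPred

/-!
Let `w` be a world of an intuitionistic model and let `falsum` be the sentence `∀ x P(x)`. A clause
`∀ x ∀ y (A → B ∨ falsum)`, with `A` and `B` built from atoms by `∧` and `∃`, says at a world where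
`falsum` fails just what it says classically about that world. Among the constituents of `A` and
`B` are equivalences `s(x) ↔ t(y)` of unary atoms; at `w` they say that `s(x)` and `t(y)` have the
same value, the value of an atom being the set of worlds above `w` at which it is true. So a formula
`⋀ clauses → (∃ x ∃ y A) ∨ falsum` is valid on every augmented frame if the clauses, read as
classical clauses about unary functions into a set of values, entail `∃ x ∃ y A`
(`valid_entailment`).

Conversely let the frame be linear with an increasing chain `e 0, e 1, …`. A classical structure
with domain and values `ℕ` becomes a model with constant domain `ℕ`, in which the value `k` is the
set of worlds above `e (k + 1)`, and `falsum` holds exactly above `e 1`. At the worlds above `e 1`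
all clauses are true because `falsum` is, and from all the others the sets that represent distinct
numbers can be told apart. So a classical counterexample refutes the formula
(`entailment_notMem_QSILc`).

Two variables suffice to describe computations by such clauses, since equality of values carries
information from one element to another without a third variable. The clauses are
those of the evaluation of `Turing.ToPartrec.Code`, programs that act on lists of numbers: every
subprogram `c` has a letter `out c` for its result and a flag `done c` for its halting. Induction on
the program shows that halting is derivable from the clauses (`done_of_mem_eval`), and when the
program does not halt, the structure of all lists, coded by numbers, satisfies the clauses and
refutes the goal (`listStructure_models_code`, `not_haltsAt_of_not_dom`). The formulas contain unary
letters only and are positive.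
-/

namespace IntPred

/-! ### Two-variable clauses about truth values of unary letters -/

/-- Positive existential formulas in the two variables `x` (`false`) and `y` (`true`). Besides the
unary predicates `p ∈ ℱ`, there are atoms `s(i) = t(j)` which say that the two unary functions
`s, t ∈ 𝒱` agree at the named arguments. -/
inductive PosEx (𝒱 ℱ : Type) : Type
  | flag (p : ℱ) (i : Bool) : PosEx 𝒱 ℱ
  | eqv (s : 𝒱) (i : Bool) (t : 𝒱) (j : Bool) : PosEx 𝒱 ℱ
  | and (A B : PosEx 𝒱 ℱ) : PosEx 𝒱 ℱ
  | exX (A : PosEx 𝒱 ℱ) : PosEx 𝒱 ℱ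
  | exY (A : PosEx 𝒱 ℱ) : PosEx 𝒱 ℱ

/-- Classical structures for `PosEx`: the letters in `𝒱` are functions from the domain `D` to a set
`β` of values, the letters in `ℱ` are predicates on `D`. -/
structure ValueStructure (𝒱 ℱ : Type) (D : Type v) (β : Type u) where
  val : 𝒱 → D → β
  holds : ℱ → D → Prop

namespace PosEx

variable {𝒱 ℱ : Type} {D : Type v} {β : Type u}

/-- Classical truth at `x = a`, `y = b`. -/
def Realize (S : ValueStructure 𝒱 ℱ D β) : PosEx 𝒱 ℱ → D → D → Prop
  | flag p i, a, b => S.holds p (cond i b a)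
  | eqv s i t j, a, b => S.val s (cond i b a) = S.val t (cond j b a)
  | and A B, a, b => A.Realize S a b ∧ B.Realize S a b
  | exX A, _, b => ∃ a, A.Realize S a b
  | exY A, a, _ => ∃ b, A.Realize S a b

end PosEx

/-- The clause `∀ x ∀ y (premise → conclusion)`. -/
structure Clause (𝒱 ℱ : Type) : Type where
  premise : PosEx 𝒱 ℱ
  conclusion : PosEx 𝒱 ℱ

/-- All clauses of the list are true in the structure. -/
def ValueStructure.Models {𝒱 ℱ : Type} {D : Type v} {β : Type u} (S : ValueStructure 𝒱 ℱ D β)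
    (T : List (Clause 𝒱 ℱ)) : Prop :=
  ∀ C ∈ T, ∀ a b, C.premise.Realize S a b → C.conclusion.Realize S a b

/-! ### Translation into positive intuitionistic formulas -/

/-- The sentence `∀ x P(x)` that takes the place of `⊥`. -/
def falsum : Formula := .all 0 (.atom 1 0 fun _ => 0)

/-- The individual variable `x₀` for `x` and `x₁` for `y`. -/
def varIndex (i : Bool) : ℕ := cond i 1 0

section Translation

variable {𝒱 ℱ : Type} [Encodable 𝒱] [Encodable ℱ]

/-- The atomic formula of a letter in `𝒱`; these have the odd indices. -/
def valueAtom (s : 𝒱) (i : Bool) : Formula :=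
  .atom 1 (2 * Encodable.encode s + 1) fun _ => varIndex i

/-- The atomic formula of a letter in `ℱ`; these have the positive even indices. -/
def flagAtom (p : ℱ) (i : Bool) : Formula :=
  .atom 1 (2 * Encodable.encode p + 2) fun _ => varIndex i

/-- The intuitionistic reading: the value of a letter is the set of worlds at which it is true, so
equality of values becomes equivalence. -/
def PosEx.toFormula : PosEx 𝒱 ℱ → Formula
  | flag p i => flagAtom p i
  | eqv s i t j =>
      .and (.imp (valueAtom s i) (valueAtom t j)) (.imp (valueAtom t j) (valueAtom s i))
  | and A B => .and A.toFormula B.toFormula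
  | exX A => .ex 0 A.toFormula
  | exY A => .ex 1 A.toFormula

/-- The disjunct `falsum` makes the clause true wherever `falsum` is, so that it restrains only the
worlds at which `falsum` fails. -/
def Clause.toFormula (C : Clause 𝒱 ℱ) : Formula :=
  .all 0 (.all 1 (.imp C.premise.toFormula (.or C.conclusion.toFormula falsum)))

/-- The conjunction of a list of clauses. -/
def theoryFormula : List (Clause 𝒱 ℱ) → Formula
  | [] => .imp falsum falsum
  | C :: T => .and C.toFormula (theoryFormula T)

/-- The formula which says that the clauses entail `∃ x ∃ y A`. -/
def entailment (T : List (Clause 𝒱 ℱ)) (A : PosEx 𝒱 ℱ) : Formula :=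
  .imp (theoryFormula T) (.or (.ex 0 (.ex 1 A.toFormula)) falsum)

theorem PosEx.positive_toFormula (A : PosEx 𝒱 ℱ) : A.toFormula.Positive := by
  induction A <;> simp_all [PosEx.toFormula, Formula.Positive, flagAtom, valueAtom]

theorem PosEx.inTwoVarLanguage_toFormula (A : PosEx 𝒱 ℱ) : A.toFormula.InTwoVarLanguage := by
  have hv : ∀ i, varIndex i < 2 := by rintro (_ | _) <;> decide
  induction A <;>
    simp_all only [PosEx.toFormula, Formula.InTwoVarLanguage, flagAtom, valueAtom, true_or,
      implies_true, and_self, zero_lt_two, one_lt_two]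

theorem positive_entailment (T : List (Clause 𝒱 ℱ)) (A : PosEx 𝒱 ℱ) :
    (entailment T A).Positive := by
  have hT : (theoryFormula T).Positive := by
    induction T <;>
      simp_all [theoryFormula, Clause.toFormula, Formula.Positive, falsum,
        PosEx.positive_toFormula]
  simp [entailment, Formula.Positive, hT, falsum, A.positive_toFormula]

theorem inTwoVarLanguage_entailment (T : List (Clause 𝒱 ℱ)) (A : PosEx 𝒱 ℱ) :
    (entailment T A).InTwoVarLanguage := by
  have hT : (theoryFormula T).InTwoVarLanguage := by
    induction T <;>
      simp_all [theoryFormula, Clause.toFormula, Formula.InTwoVarLanguage, falsum,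
        PosEx.inTwoVarLanguage_toFormula]
  simp [entailment, Formula.InTwoVarLanguage, hT, falsum, A.inTwoVarLanguage_toFormula]

/-! ### Classical entailment implies validity -/

/-- The classical structure seen from a world: its domain is the domain of the world, the value of a
letter is the set of accessible worlds at which it is true. -/
def Model.structureAt {A : AugFrame.{u, v}} (M : Model A) (w : A.frame.World) :
    ValueStructure 𝒱 ℱ (A.D w) (Set A.frame.World) where
  val s a := {z | A.frame.R w z ∧ (fun _ => (a : A.Ind)) ∈ M.I z 1 (2 * Encodable.encode s + 1)}
  holds p a := (fun _ => (a : A.Ind)) ∈ M.I w 1 (2 * Encodable.encode p + 2)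

theorem Model.sat_toFormula {A : AugFrame.{u, v}} (M : Model A) (w : A.frame.World)
    (B : PosEx 𝒱 ℱ) (g : ℕ → A.Ind) (a b : A.D w) (ha : g 0 = a) (hb : g 1 = b) :
    M.Sat w g B.toFormula ↔ B.Realize (M.structureAt w) a b := by
  have hg : ∀ i, g (varIndex i) = (cond i b a : A.D w) := by
    rintro (_ | _) <;> simp [varIndex, ha, hb]
  induction B generalizing g a b with
  | flag p i => simp [PosEx.toFormula, flagAtom, Model.Sat, PosEx.Realize, structureAt, hg]
  | eqv s i t j =>
    simp only [PosEx.toFormula, valueAtom, Model.Sat, PosEx.Realize, structureAt, hg, Set.ext_iff,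
      Set.mem_ofPred_eq]
    constructor
    · rintro ⟨h₁, h₂⟩ z
      exact ⟨fun h => ⟨h.1, h₁ z h.1 h.2⟩, fun h => ⟨h.1, h₂ z h.1 h.2⟩⟩
    · intro h
      exact ⟨fun z hz hs => ((h z).1 ⟨hz, hs⟩).2, fun z hz hs => ((h z).2 ⟨hz, hs⟩).2⟩
  | and B C hB hC =>
    simp only [PosEx.toFormula, Model.Sat, PosEx.Realize, hB g a b ha hb hg, hC g a b ha hb hg]
  | exX B ih =>
    have h : ∀ c : A.D w, M.Sat w (Function.update g 0 c) B.toFormula ↔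
        B.Realize (M.structureAt w) c b := fun c =>
      ih _ c b (by simp) (by simp [hb]) (by rintro (_ | _) <;> simp [varIndex, hb])
    constructor
    · rintro ⟨c, hc, hs⟩
      exact ⟨⟨c, hc⟩, (h ⟨c, hc⟩).1 hs⟩
    · rintro ⟨c, hc⟩
      exact ⟨c, c.2, (h c).2 hc⟩
  | exY B ih =>
    have h : ∀ c : A.D w, M.Sat w (Function.update g 1 c) B.toFormula ↔
        B.Realize (M.structureAt w) a c := fun c =>
      ih _ a c (by simp [ha]) (by simp) (by rintro (_ | _) <;> simp [varIndex, ha])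
    constructor
    · rintro ⟨c, hc, hs⟩
      exact ⟨⟨c, hc⟩, (h ⟨c, hc⟩).1 hs⟩
    · rintro ⟨c, hc⟩
      exact ⟨c, c.2, (h c).2 hc⟩

theorem Model.sat_theoryFormula {A : AugFrame.{u, v}} (M : Model A) (w : A.frame.World)
    (g : ℕ → A.Ind) (T : List (Clause 𝒱 ℱ)) :
    M.Sat w g (theoryFormula T) ↔ ∀ C ∈ T, M.Sat w g C.toFormula := by
  induction T with
  | nil => simp [theoryFormula, Model.Sat]
  | cons C T ih => simp [theoryFormula, Model.Sat, ih]

theorem Model.sat_falsum_congr {A : AugFrame.{u, v}} (M : Model A) (w : A.frame.World)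
    (g g' : ℕ → A.Ind) : M.Sat w g falsum ↔ M.Sat w g' falsum := by
  simp [falsum, Model.Sat]

/-- At a world at which `falsum` fails, the clauses are classical two-variable clauses about the
structure seen from that world. -/
theorem valid_entailment (T : List (Clause 𝒱 ℱ)) (B : PosEx 𝒱 ℱ) (A : AugFrame.{u, v})
    (h : ∀ (D : Type v) (β : Type u) (S : ValueStructure 𝒱 ℱ D β), Nonempty D → S.Models T →
      ∃ a b, B.Realize S a b) : A.Valid (entailment T B) := by
  intro M w₀ g _ w _ hT
  by_cases hG : M.Sat w g falsum
  · exact Or.inr hG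
  refine Or.inl ?_
  have hS : (M.structureAt w : ValueStructure 𝒱 ℱ _ _).Models T := by
    intro C hC a b hp
    have hs := (M.sat_theoryFormula w g T).1 hT C hC w (A.frame.refl w) a a.2 w (A.frame.refl w)
      b b.2 w (A.frame.refl w) ((M.sat_toFormula w _ _ a b (by simp) (by simp)).2 hp)
    rcases hs with hs | hs
    · exact (M.sat_toFormula w _ _ a b (by simp) (by simp)).1 hs
    · exact absurd ((M.sat_falsum_congr w _ _).1 hs) hG
  obtain ⟨a, b, hab⟩ := h _ _ _ (A.nonempty w).to_subtype hS
  exact ⟨a, a.2, b, b.2, (M.sat_toFormula w _ _ a b (by simp) (by simp)).2 hab⟩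

/-! ### Countermodels over chains of type `ω` -/

section Chain

variable (F : KripkeFrame.{u})

/-- The augmented frame with constant domain `ℕ`. -/
abbrev natFrame : AugFrame.{u, v} where
  frame := F
  Ind := ULift.{v} ℕ
  D _ := Set.univ
  nonempty _ := Set.univ_nonempty
  expanding _ _ _ := subset_rfl

variable {F}

/-- The model in which the value `k` is represented by the set of worlds above `e (k + 1)`. All of
`falsum` and the predicates in `ℱ` become true at `e 1`, so that only worlds not above `e 1` matter,
and from each of these all the numerical values can be told apart. -/
def chainModel (e : ℕ → F.World) (S : ValueStructure 𝒱 ℱ ℕ ℕ) : Model (natFrame.{u, v} F) where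
  I w _ i := {a | ∀ k, (i = 0 → F.R (e 1) w) ∧
    (∀ s : 𝒱, i = 2 * Encodable.encode s + 1 → F.R (e (S.val s (a k).down + 1)) w) ∧
    (∀ p : ℱ, i = 2 * Encodable.encode p + 2 → F.R (e 1) w ∨ S.holds p (a k).down)}
  I_subset _ _ _ _ _ _ := trivial
  hereditary _ _ hw _ _ _ ha k :=
    ⟨fun h => F.trans _ _ _ ((ha k).1 h) hw, fun s h => F.trans _ _ _ ((ha k).2.1 s h) hw,
      fun p h => ((ha k).2.2 p h).imp_left fun h' => F.trans _ _ _ h' hw⟩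

variable (e : ℕ → F.World) (S : ValueStructure 𝒱 ℱ ℕ ℕ)

theorem chainModel_valueAtom (w : F.World) (g : ℕ → ULift.{v} ℕ) (s : 𝒱) (i : Bool) :
    (chainModel.{u, v} e S).Sat w g (valueAtom s i) ↔
      F.R (e (S.val s (g (varIndex i)).down + 1)) w := by
  have h2 : ∀ n : ℕ, 2 * Encodable.encode s + 1 ≠ 2 * n + 2 := by omega
  simp only [valueAtom, Model.Sat, chainModel, Set.mem_ofPred_eq]
  constructor
  · exact fun h => (h 0).2.1 s rfl
  · refine fun h _ => ⟨fun h0 => by omega, fun t ht => ?_, fun p hp => absurd hp (h2 _)⟩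
    obtain rfl : s = t := Encodable.encode_injective (by omega)
    exact h

theorem chainModel_flagAtom (w : F.World) (g : ℕ → ULift.{v} ℕ) (p : ℱ) (i : Bool) :
    (chainModel.{u, v} e S).Sat w g (flagAtom p i) ↔
      F.R (e 1) w ∨ S.holds p (g (varIndex i)).down := by
  have h2 : ∀ n : ℕ, 2 * Encodable.encode p + 2 ≠ 2 * n + 1 := by omega
  simp only [flagAtom, Model.Sat, chainModel, Set.mem_ofPred_eq]
  constructor
  · exact fun h => (h 0).2.2 p rfl
  · refine fun h _ => ⟨fun h0 => by omega, fun t ht => absurd ht (h2 _), fun q hq => ?_⟩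
    obtain rfl : p = q := Encodable.encode_injective (by omega)
    exact h

theorem chainModel_falsum (w : F.World) (g : ℕ → ULift.{v} ℕ) :
    (chainModel.{u, v} e S).Sat w g falsum ↔ F.R (e 1) w := by
  simp only [falsum, Model.Sat, chainModel, Set.mem_ofPred_eq]
  constructor
  · exact fun h => (h w (F.refl w) ⟨0⟩ trivial 0).1 trivial
  · exact fun h z hz a _ k =>
      ⟨fun _ => F.trans _ _ _ h hz, fun s hs => by omega, fun p hp => by omega⟩

theorem chainModel_toFormula (htot : ∀ a b, F.R a b ∨ F.R b a)
    (he : ∀ m n, F.R (e m) (e n) ↔ m ≤ n) (w : F.World) (hw : ¬ F.R (e 1) w) (B : PosEx 𝒱 ℱ)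
    (g : ℕ → ULift.{v} ℕ) (a b : ℕ) (ha : (g 0).down = a) (hb : (g 1).down = b) :
    (chainModel.{u, v} e S).Sat w g B.toFormula ↔ B.Realize S a b := by
  have hg : ∀ i, (g (varIndex i)).down = cond i b a := by
    rintro (_ | _) <;> simp [varIndex, ha, hb]
  induction B generalizing g a b with
  | flag p i => simp only [PosEx.toFormula, chainModel_flagAtom, PosEx.Realize, hg, hw, false_or]
  | eqv s i t j =>
    simp only [PosEx.toFormula, Model.Sat, PosEx.Realize, chainModel_valueAtom, hg]
    constructor
    · -- The world `e (m + 1)` is accessible from `w`, and it separates `m` from larger values.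
      have key : ∀ m n : ℕ, (∀ z, F.R w z → F.R (e (m + 1)) z → F.R (e (n + 1)) z) → n ≤ m := by
        intro m n h
        have hwm : F.R w (e (m + 1)) :=
          F.trans _ _ _ ((htot _ _).resolve_left hw) ((he 1 (m + 1)).2 (by omega))
        have := (he _ _).1 (h _ hwm (F.refl _))
        omega
      rintro ⟨h₁, h₂⟩
      exact le_antisymm (key _ _ h₂) (key _ _ h₁)
    · intro h
      rw [h]
      exact ⟨fun _ _ h => h, fun _ _ h => h⟩
  | and B C hB hC =>
    simp only [PosEx.toFormula, Model.Sat, PosEx.Realize, hB g a b ha hb hg, hC g a b ha hb hg]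
  | exX B ih =>
    have h : ∀ c : ℕ, (chainModel.{u, v} e S).Sat w (Function.update g 0 ⟨c⟩) B.toFormula ↔
        B.Realize S c b := fun c =>
      ih _ c b (by simp) (by simp [hb]) (by rintro (_ | _) <;> simp [varIndex, hb])
    constructor
    · rintro ⟨c, _, hs⟩
      exact ⟨c.down, (h c.down).1 hs⟩
    · rintro ⟨c, hc⟩
      exact ⟨⟨c⟩, trivial, (h c).2 hc⟩
  | exY B ih =>
    have h : ∀ c : ℕ, (chainModel.{u, v} e S).Sat w (Function.update g 1 ⟨c⟩) B.toFormula ↔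
        B.Realize S a c := fun c =>
      ih _ a c (by simp [ha]) (by simp) (by rintro (_ | _) <;> simp [varIndex, ha])
    constructor
    · rintro ⟨c, _, hs⟩
      exact ⟨c.down, (h c.down).1 hs⟩
    · rintro ⟨c, hc⟩
      exact ⟨⟨c⟩, trivial, (h c).2 hc⟩

/-- A classical counterexample over `ℕ` yields an intuitionistic one with constant domains. -/
theorem entailment_notMem_QSILc (htot : ∀ a b, F.R a b ∨ F.R b a)
    (he : ∀ m n, F.R (e m) (e n) ↔ m ≤ n) (T : List (Clause 𝒱 ℱ)) (B : PosEx 𝒱 ℱ)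
    (hS : S.Models T) (hB : ¬ ∃ a b, B.Realize S a b) :
    entailment T B ∉ QSILc.{u, v} F := by
  intro hmem
  have h0 : ¬ F.R (e 1) (e 0) := fun h => absurd ((he _ _).1 h) (by omega)
  have hT : (chainModel.{u, v} e S).Sat (e 0) (fun _ => ⟨0⟩) (theoryFormula T) := by
    rw [Model.sat_theoryFormula]
    intro C hC _ _ a _ _ _ b _ w _ hp
    by_cases hw : F.R (e 1) w
    · exact Or.inr ((chainModel_falsum e S w _).2 hw)
    · refine Or.inl ((chainModel_toFormula e S htot he w hw _ _ a.down b.down (by simp)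
        (by simp)).2 (hS C hC _ _ ?_))
      exact (chainModel_toFormula e S htot he w hw _ _ a.down b.down (by simp) (by simp)).1 hp
  rcases hmem (natFrame.{u, v} F) ⟨rfl, fun _ _ _ => rfl⟩ (chainModel.{u, v} e S) (e 0)
    (fun _ => ⟨0⟩) (fun _ _ => trivial) (e 0) (F.refl _) hT with h | h
  · obtain ⟨a, _, b, _, hab⟩ := h
    exact hB ⟨a.down, b.down, (chainModel_toFormula e S htot he _ h0 _ _ a.down b.down (by simp)
      (by simp)).1 hab⟩
  · exact h0 ((chainModel_falsum e S _ _).1 h)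

end Chain

end Translation

/-! ### Clauses for computations on lists -/

open Turing.ToPartrec (Code)

/-- The value letters. In the intended structure the domain and the set of values are `ℕ`, and a
number `a` also stands for the list of numbers which it encodes; `self` is the identity, `headSucc a`
and `headPred a` are the successor and the predecessor of the head of `a`, `predCons a` encodes the
list with head `headPred a` and tail `tail a`, `single a` encodes `[a]`, and `out c a` is the result
of the program `c` at `a`, with head `outHead c a` and tail `outTail c a`. -/
inductive ValueLetter : Type
  | self | zero | succ | head | tail | headSucc | headPred | predCons | single
  | out (c : Code) | outHead (c : Code) | outTail (c : Code)

/-- The flag letters; `done c` says that the program `c` halts. -/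
inductive FlagLetter : Type
  | isZero | isCons | done (c : Code)

/-- An injection of programs into the natural numbers. -/
def codeIndex : Code → ℕ
  | .zero' => 0
  | .succ => 1
  | .tail => 2
  | .cons f g => 4 * Nat.pair (codeIndex f) (codeIndex g) + 3
  | .comp f g => 4 * Nat.pair (codeIndex f) (codeIndex g) + 4
  | .case f g => 4 * Nat.pair (codeIndex f) (codeIndex g) + 5
  | .fix f => 4 * codeIndex f + 6

theorem codeIndex_injective : Function.Injective codeIndex := by
  intro c
  induction c with
  | zero' | succ | tail => intro d h; cases d <;> simp only [codeIndex] at h <;> first | rfl | omega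
  | cons f g ihf ihg | comp f g ihf ihg | case f g ihf ihg =>
    intro d h
    cases d <;> simp only [codeIndex] at h <;> first
      | omega
      | (simp only [Nat.add_right_cancel_iff, Nat.mul_left_cancel_iff four_pos,
           Nat.pair_eq_pair] at h
         rw [ihf h.1, ihg h.2])
  | fix f ih =>
    intro d h
    cases d <;> simp only [codeIndex] at h <;> first
      | omega
      | (congr 1
         exact ih (by omega))

/-- An injection of the value letters into the natural numbers. -/
def ValueLetter.index : ValueLetter → ℕ
  | self => 0 | zero => 1 | succ => 2 | head => 3 | tail => 4 | headSucc => 5 | headPred => 6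
  | predCons => 7 | single => 8
  | out c => 3 * codeIndex c + 9 | outHead c => 3 * codeIndex c + 10
  | outTail c => 3 * codeIndex c + 11

/-- An injection of the flag letters into the natural numbers. -/
def FlagLetter.index : FlagLetter → ℕ
  | isZero => 0 | isCons => 1 | done c => codeIndex c + 2

theorem ValueLetter.index_injective : Function.Injective ValueLetter.index := by
  intro s t h
  cases s <;> cases t <;> simp only [ValueLetter.index] at h <;> first
    | rfl
    | omega
    | (congr 1
       exact codeIndex_injective (by omega))

theorem FlagLetter.index_injective : Function.Injective FlagLetter.index := by
  intro s t h
  cases s <;> cases t <;> simp only [FlagLetter.index] at h <;> first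
    | rfl
    | omega
    | (congr 1
       exact codeIndex_injective (by omega))

noncomputable instance : Encodable ValueLetter :=
  haveI := ValueLetter.index_injective.countable
  Encodable.ofCountable _

noncomputable instance : Encodable FlagLetter :=
  haveI := FlagLetter.index_injective.countable
  Encodable.ofCountable _

/-- Positive existential formulas in the letters for list programs. -/
abbrev ListFormula : Type := PosEx ValueLetter FlagLetter

namespace ListFormula

/-- `s(x) = t(x)`. -/
abbrev eqXX (s t : ValueLetter) : ListFormula := .eqv s false t false

/-- `s(x) = t(y)`. -/
abbrev eqXY (s t : ValueLetter) : ListFormula := .eqv s false t true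

/-- A formula which is always true. -/
abbrev top : ListFormula := eqXX .self .self

/-- The list with head `s(x)` and tail `t(x)` exists, and its value is `r(x)`. -/
abbrev consOf (s t r : ValueLetter) : ListFormula :=
  .exY (.and (.and (.flag .isCons true) (eqXY r .self)) (.and (eqXY s .head) (eqXY t .tail)))

/-- The program `c` halts at `x` with result `s(x)`. -/
abbrev resultX (c : Code) (s : ValueLetter) : ListFormula :=
  .and (.flag (.done c) false) (eqXX (.out c) s)

/-- The program `c` halts at `x`, with the result of `d` at `y`. -/
abbrev resultXY (c d : Code) : ListFormula :=
  .and (.flag (.done c) false) (eqXY (.out c) (.out d))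

/-- The program `d` halts at `y`, and `y` is the value `s(x)`. -/
abbrev callY (d : Code) (s : ValueLetter) : ListFormula :=
  .and (.flag (.done d) true) (eqXY s .self)

end ListFormula

open ListFormula

/-- Clauses on numbers and lists. -/
def baseClauses : List (Clause ValueLetter FlagLetter) :=
  [⟨top, .exX (.flag .isZero false)⟩,
   ⟨.flag .isZero true, eqXY .zero .self⟩,
   ⟨.flag .isZero false, .and (eqXX .head .self) (eqXX .tail .self)⟩,
   ⟨eqXY .self .self, .and (eqXY .head .head) (eqXY .tail .tail)⟩,
   ⟨top, .exY (eqXY .succ .self)⟩,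
   ⟨eqXY .head .self, eqXY .headSucc .succ⟩,
   ⟨eqXY .head .succ, eqXY .headPred .self⟩,
   ⟨top, consOf .headPred .tail .predCons⟩,
   ⟨top, consOf .self .zero .single⟩]

/-- Clauses which force `done c` and `out c` to obey the recursive definition of the value of the
program `c`. Intermediate results that involve a third element are stored in a letter at `x`. -/
def codeClauses : Code → List (Clause ValueLetter FlagLetter)
  | .zero' => [⟨top, .and (.flag (.done .zero') false) (consOf .zero .self (.out .zero'))⟩]
  | .succ => [⟨top, .and (.flag (.done .succ) false) (consOf .headSucc .zero (.out .succ))⟩]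
  | .tail => [⟨top, resultX .tail .tail⟩]
  | .cons f fs => codeClauses f ++ codeClauses fs ++
      [⟨eqXY (.out f) .self, eqXY (.outHead f) .head⟩,
       ⟨.and (.flag (.done f) false) (.flag (.done fs) false),
        .and (.flag (.done (.cons f fs)) false)
          (consOf (.outHead f) (.out fs) (.out (.cons f fs)))⟩]
  | .comp f g => codeClauses f ++ codeClauses g ++
      [⟨.and (.flag (.done g) false) (callY f (.out g)), resultXY (.comp f g) f⟩]
  | .case f g => codeClauses f ++ codeClauses g ++
      [⟨.and (eqXX .head .zero) (callY f .tail), resultXY (.case f g) f⟩,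
       ⟨.and (.exY (eqXY .head .succ)) (callY g .predCons), resultXY (.case f g) g⟩]
  | .fix f => codeClauses f ++
      [⟨eqXY (.out f) .self, .and (eqXY (.outHead f) .head) (eqXY (.outTail f) .tail)⟩,
       ⟨.and (.flag (.done f) false) (eqXX (.outHead f) .zero),
        resultX (.fix f) (.outTail f)⟩,
       ⟨.and (.and (.flag (.done f) false) (.exY (eqXY (.outHead f) .succ)))
          (callY (.fix f) (.outTail f)), resultXY (.fix f) (.fix f)⟩]

/-- `x` is the numeral `n`. -/
def numeral : ℕ → ListFormula
  | 0 => .flag .isZero false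
  | n + 1 => .exY (.and (eqXY .self .succ) (.exX (.and (eqXY .self .self) (numeral n))))

/-- `x` is the numeral `n`, and `y` is the list `[n]`, at which the program `c` halts. -/
def haltsAt (c : Code) (n : ℕ) : ListFormula := .and (numeral n) (callY c .single)

/-! ### Deriving the halting of a program -/

section Derivation

variable {D : Type v} {β : Type u} (S : ValueStructure ValueLetter FlagLetter D β)

/-- The value `p` represents the number `n`: it arises from the value of a zero element by `n`
successor steps. -/
def NumRep : ℕ → β → Prop
  | 0, p => ∃ a, S.holds .isZero a ∧ p = S.val .self a
  | n + 1, p => ∃ a, NumRep n (S.val .self a) ∧ p = S.val .succ a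

/-- The value `p` represents the list `l`. -/
def ListRep : List ℕ → β → Prop
  | [], p => ∃ a, S.holds .isZero a ∧ p = S.val .self a
  | n :: l, p => ∃ a, S.holds .isCons a ∧ p = S.val .self a ∧ NumRep S n (S.val .head a) ∧
      ListRep l (S.val .tail a)

variable {S}

theorem ListRep.exists_self {l : List ℕ} {p : β} (h : ListRep S l p) :
    ∃ a, p = S.val .self a := by
  cases l with
  | nil => obtain ⟨a, -, h⟩ := h; exact ⟨a, h⟩
  | cons n l => obtain ⟨a, -, h, -⟩ := h; exact ⟨a, h⟩

theorem consOf_listRep {s t r : ValueLetter} {a b : D} {n : ℕ} {l : List ℕ}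
    (h : (consOf s t r).Realize S a b) (hn : NumRep S n (S.val s a))
    (hl : ListRep S l (S.val t a)) : ListRep S (n :: l) (S.val r a) := by
  obtain ⟨c, ⟨hc, hr⟩, hs, ht⟩ := h
  exact ⟨c, hc, hr, Eq.subst (motive := NumRep S n) hs hn, Eq.subst (motive := ListRep S l) ht hl⟩

theorem models_append {T T' : List (Clause ValueLetter FlagLetter)} :
    S.Models (T ++ T') ↔ S.Models T ∧ S.Models T' := by
  simp [ValueStructure.Models, or_imp, forall_and]

theorem mem_comp_eval {f g : Code} {l r : List ℕ} :
    r ∈ (Code.comp f g).eval l ↔ ∃ w ∈ g.eval l, r ∈ f.eval w := by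
  rw [Code.comp_eval]
  exact Part.mem_bind_iff

theorem mem_fix_eval {f : Code} {l r : List ℕ} :
    r ∈ (Code.fix f).eval l ↔
      ∃ w ∈ f.eval l, if w.headI = 0 then r = w.tail else r ∈ (Code.fix f).eval w.tail := by
  rw [Code.fix_eval]
  refine PFun.mem_fix_iff.trans ?_
  simp only [Part.mem_map_iff]
  constructor
  · rintro (⟨w, hw, h⟩ | ⟨l', ⟨w, hw, h⟩, hr⟩) <;> refine ⟨w, hw, ?_⟩ <;> split_ifs at h ⊢
    · exact (Sum.inl.inj h).symm
    · exact Sum.inr.inj h ▸ hr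
  · rintro ⟨w, hw, h⟩
    split_ifs at h with h0
    · exact Or.inl ⟨w, hw, by rw [if_pos h0, h]⟩
    · exact Or.inr ⟨w.tail, ⟨w, hw, if_neg h0⟩, h⟩

/-- Only the value of `a` is assumed to represent `l`; the clause that makes `head` and `tail` depend
on `self` alone transfers the structure of `l` to `a`. -/
theorem headI_tail_rep (hS : S.Models baseClauses) {l : List ℕ} {a : D}
    (h : ListRep S l (S.val .self a)) :
    NumRep S l.headI (S.val .head a) ∧ ListRep S l.tail (S.val .tail a) := by
  simp only [ValueStructure.Models, baseClauses, List.forall_mem_cons, PosEx.Realize, cond_true,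
    cond_false] at hS
  obtain ⟨-, -, hz, hc, -⟩ := hS
  cases l with
  | nil =>
    obtain ⟨b, hb, hab⟩ := h
    obtain ⟨h₁, h₂⟩ := hc a b hab
    obtain ⟨h₃, h₄⟩ := hz b b hb
    exact ⟨⟨b, hb, h₁.trans h₃⟩, ⟨b, hb, h₂.trans h₄⟩⟩
  | cons n l =>
    obtain ⟨b, -, hab, hn, hl⟩ := h
    obtain ⟨h₁, h₂⟩ := hc a b hab
    rw [h₁, h₂]
    exact ⟨hn, hl⟩

theorem zero_rep [Nonempty D] (hS : S.Models baseClauses) (a : D) :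
    NumRep S 0 (S.val .zero a) ∧ ListRep S [] (S.val .zero a) := by
  simp only [ValueStructure.Models, baseClauses, List.forall_mem_cons, PosEx.Realize, cond_true,
    cond_false] at hS
  obtain ⟨hex, hz, -⟩ := hS
  obtain ⟨b, hb⟩ := hex a a trivial
  exact ⟨⟨b, hb, hz a b hb⟩, ⟨b, hb, hz a b hb⟩⟩

theorem NumRep.exists_self (hS : S.Models baseClauses) {n : ℕ} {p : β} (h : NumRep S n p) :
    ∃ a, p = S.val .self a := by
  simp only [ValueStructure.Models, baseClauses, List.forall_mem_cons, PosEx.Realize, cond_true,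
    cond_false] at hS
  obtain ⟨-, -, -, -, hs, -⟩ := hS
  cases n with
  | zero => obtain ⟨a, -, h⟩ := h; exact ⟨a, h⟩
  | succ n =>
    obtain ⟨a, -, rfl⟩ := h
    exact hs a a trivial

theorem headSucc_rep (hS : S.Models baseClauses) {n : ℕ} {a : D}
    (h : NumRep S n (S.val .head a)) : NumRep S (n + 1) (S.val .headSucc a) := by
  obtain ⟨b, hb⟩ := h.exists_self hS
  simp only [ValueStructure.Models, baseClauses, List.forall_mem_cons, PosEx.Realize, cond_true,
    cond_false] at hS
  obtain ⟨-, -, -, -, -, hs, -⟩ := hS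
  exact ⟨b, hb ▸ h, hs a b hb⟩

theorem predCons_rep (hS : S.Models baseClauses) {n : ℕ} {l : List ℕ} {a : D}
    (h : NumRep S (n + 1) (S.val .head a)) (hl : ListRep S l (S.val .tail a)) :
    ListRep S (n :: l) (S.val .predCons a) := by
  simp only [ValueStructure.Models, baseClauses, List.forall_mem_cons] at hS
  obtain ⟨-, -, -, -, -, -, hp, hc, -⟩ := hS
  obtain ⟨b, hb, hab⟩ := h
  refine consOf_listRep (hc a a rfl) ?_ hl
  have : S.val .headPred a = S.val .self b := hp a b hab
  rwa [this]

theorem single_rep [Nonempty D] (hS : S.Models baseClauses) {n : ℕ} {a : D}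
    (h : NumRep S n (S.val .self a)) : ListRep S [n] (S.val .single a) := by
  have h0 := (zero_rep hS a).2
  simp only [ValueStructure.Models, baseClauses, List.forall_mem_cons] at hS
  obtain ⟨-, -, -, -, -, -, -, -, hc, -⟩ := hS
  exact consOf_listRep (hc a a rfl) h h0

/-- Induction on the program, and on the number of iterations for `Code.fix`. -/
theorem done_of_mem_eval [Nonempty D] (hS : S.Models baseClauses) (c : Code)
    (hc : S.Models (codeClauses c)) {l r : List ℕ} (hr : r ∈ c.eval l) {a : D}
    (ha : ListRep S l (S.val .self a)) :
    S.holds (.done c) a ∧ ListRep S r (S.val (.out c) a) := by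
  have heq : ∀ {s t : ValueLetter} {a b : D} {l : List ℕ}, S.val s a = S.val t b →
      ListRep S l (S.val t b) → ListRep S l (S.val s a) := fun h h' => h ▸ h'
  induction c generalizing l r a with
  | zero' =>
    simp only [Code.zero'_eval, Part.pure_eq_some, Part.mem_some_iff] at hr
    subst hr
    obtain ⟨hd, hco⟩ := hc _ (List.mem_singleton_self _) a a rfl
    exact ⟨hd, consOf_listRep hco (zero_rep hS a).1 ha⟩
  | succ =>
    simp only [Code.succ_eval, Part.pure_eq_some, Part.mem_some_iff] at hr
    subst hr
    obtain ⟨hd, hco⟩ := hc _ (List.mem_singleton_self _) a a rfl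
    exact ⟨hd, consOf_listRep hco (headSucc_rep hS (headI_tail_rep hS ha).1) (zero_rep hS a).2⟩
  | tail =>
    simp only [Code.tail_eval, Part.pure_eq_some, Part.mem_some_iff] at hr
    subst hr
    obtain ⟨hd, ho⟩ := hc _ (List.mem_singleton_self _) a a rfl
    exact ⟨hd, heq ho (headI_tail_rep hS ha).2⟩
  | cons f fs ihf ihfs =>
    rw [codeClauses, models_append, models_append] at hc
    obtain ⟨⟨hf, hfs⟩, hc⟩ := hc
    simp only [ValueStructure.Models, List.forall_mem_cons] at hc
    obtain ⟨hh, hc, -⟩ := hc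
    simp only [Code.cons_eval, Part.bind_eq_bind, Part.mem_bind_iff, Part.pure_eq_some,
      Part.mem_some_iff] at hr
    obtain ⟨r₁, hr₁, r₂, hr₂, rfl⟩ := hr
    obtain ⟨d₁, o₁⟩ := ihf hf hr₁ ha
    obtain ⟨d₂, o₂⟩ := ihfs hfs hr₂ ha
    obtain ⟨b, hb⟩ := o₁.exists_self
    have hn := (headI_tail_rep hS (hb ▸ o₁)).1
    have hhb : S.val (.outHead f) a = S.val .head b := hh a b hb
    obtain ⟨hd, hco⟩ := hc a a ⟨d₁, d₂⟩
    exact ⟨hd, consOf_listRep hco (hhb ▸ hn) o₂⟩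
  | comp f g ihf ihg =>
    rw [codeClauses, models_append, models_append] at hc
    obtain ⟨⟨hf, hg⟩, hc⟩ := hc
    obtain ⟨r₁, hr₁, hr₂⟩ := mem_comp_eval.1 hr
    obtain ⟨d₁, o₁⟩ := ihg hg hr₁ ha
    obtain ⟨b, hb⟩ := o₁.exists_self
    obtain ⟨d₂, o₂⟩ := ihf hf hr₂ (hb ▸ o₁)
    obtain ⟨hd, ho⟩ := hc _ (List.mem_singleton_self _) a b ⟨d₁, d₂, hb⟩
    exact ⟨hd, heq ho o₂⟩
  | case f g ihf ihg =>
    rw [codeClauses, models_append, models_append] at hc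
    obtain ⟨⟨hf, hg⟩, hc⟩ := hc
    simp only [ValueStructure.Models, List.forall_mem_cons] at hc
    obtain ⟨hc₀, hc₁, -⟩ := hc
    simp only [Code.case_eval] at hr
    obtain ⟨hh, ht⟩ := headI_tail_rep hS ha
    rcases hl : l.headI with _ | n
    · rw [hl] at hr hh
      obtain ⟨b, hb⟩ := ht.exists_self
      obtain ⟨d₁, o₁⟩ := ihf hf hr (hb ▸ ht)
      obtain ⟨z, hz, hza⟩ := hh
      have h0 : S.val .zero a = S.val .self z := hS _ (List.mem_cons_of_mem _ List.mem_cons_self)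
        a z hz
      obtain ⟨hd, ho⟩ := hc₀ a b ⟨hza.trans h0.symm, d₁, hb⟩
      exact ⟨hd, heq ho o₁⟩
    · rw [hl] at hr hh
      have hp := predCons_rep hS hh ht
      obtain ⟨b, hb⟩ := hp.exists_self
      obtain ⟨d₁, o₁⟩ := ihg hg hr (hb ▸ hp)
      obtain ⟨z, -, hz⟩ := hh
      obtain ⟨hd, ho⟩ := hc₁ a b ⟨⟨z, hz⟩, d₁, hb⟩
      exact ⟨hd, heq ho o₁⟩
  | fix f ih =>
    rw [codeClauses, models_append] at hc
    obtain ⟨hf, hc⟩ := hc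
    simp only [ValueStructure.Models, List.forall_mem_cons] at hc
    obtain ⟨hh, hc₀, hc₁, -⟩ := hc
    rw [Code.fix_eval] at hr
    -- The result `w` of one run of `f`, and where its head and tail are stored.
    have hstep : ∀ {l w : List ℕ}, w ∈ f.eval l → ∀ {a : D}, ListRep S l (S.val .self a) →
        S.holds (.done f) a ∧ NumRep S w.headI (S.val (.outHead f) a) ∧
          ListRep S w.tail (S.val (.outTail f) a) := by
      intro l w hw a ha
      obtain ⟨d, o⟩ := ih hf hw ha
      obtain ⟨b, hb⟩ := o.exists_self
      obtain ⟨h₁, h₂⟩ := headI_tail_rep hS (hb ▸ o)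
      obtain ⟨e₁, e₂⟩ := hh a b hb
      exact ⟨d, Eq.subst (motive := NumRep S _) e₁.symm h₁, heq e₂ h₂⟩
    refine PFun.fixInduction' (C := fun l => ∀ {a : D}, ListRep S l (S.val .self a) →
      S.holds (.done (.fix f)) a ∧ ListRep S r (S.val (.out (.fix f)) a)) hr ?_ ?_ ha
    · intro l hl a ha
      obtain ⟨w, hw, hwr⟩ := (Part.mem_map_iff _).1 hl
      obtain ⟨d, h₁, h₂⟩ := hstep hw ha
      split_ifs at hwr with h0
      obtain rfl := Sum.inl.inj hwr
      rw [h0] at h₁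
      obtain ⟨z, hz, hza⟩ := h₁
      have h0 : S.val .zero a = S.val .self z := hS _ (List.mem_cons_of_mem _ List.mem_cons_self)
        a z hz
      obtain ⟨hd, ho⟩ := hc₀ a a ⟨d, hza.trans h0.symm⟩
      exact ⟨hd, heq ho h₂⟩
    · intro l l' _ hl ih' a ha
      obtain ⟨w, hw, hwr⟩ := (Part.mem_map_iff _).1 hl
      obtain ⟨d, h₁, h₂⟩ := hstep hw ha
      split_ifs at hwr with h0
      obtain rfl := Sum.inr.inj hwr
      obtain ⟨n, hn⟩ := Nat.exists_eq_succ_of_ne_zero h0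
      rw [hn] at h₁
      obtain ⟨z, -, hz⟩ := h₁
      obtain ⟨b, hb⟩ := h₂.exists_self
      obtain ⟨d', o'⟩ := ih' (hb ▸ h₂)
      obtain ⟨hd, ho⟩ := hc₁ a b ⟨⟨d, z, hz⟩, d', hb⟩
      exact ⟨hd, heq ho o'⟩

theorem exists_numeral [Nonempty D] (hS : S.Models baseClauses) (n : ℕ) :
    ∃ a, NumRep S n (S.val .self a) ∧ ∀ b, (numeral n).Realize S a b := by
  induction n with
  | zero =>
    obtain ⟨a⟩ := ‹Nonempty D›
    obtain ⟨b, hb⟩ := hS _ List.mem_cons_self a a rfl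
    exact ⟨b, ⟨b, hb, rfl⟩, fun _ => hb⟩
  | succ n ih =>
    obtain ⟨a, ha, hn⟩ := ih
    have hr : NumRep S (n + 1) (S.val .succ a) := ⟨a, ha, rfl⟩
    obtain ⟨b, hb⟩ := hr.exists_self hS
    exact ⟨b, hb ▸ hr, fun _ => ⟨a, hb.symm, a, rfl, hn a⟩⟩

theorem exists_haltsAt [Nonempty D] (c : Code) (hS : S.Models (baseClauses ++ codeClauses c))
    {n : ℕ} (hn : (c.eval [n]).Dom) : ∃ a b, (haltsAt c n).Realize S a b := by
  obtain ⟨hS, hc⟩ := models_append.1 hS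
  obtain ⟨a, ha, hna⟩ := exists_numeral hS n
  have h := single_rep hS ha
  obtain ⟨b, hb⟩ := h.exists_self
  exact ⟨a, b, hna b, (done_of_mem_eval hS c hc (Part.get_mem hn) (hb ▸ h)).1, hb⟩

end Derivation

/-! ### The intended structure -/

/-- The list encoded by a number. -/
def listOf (a : ℕ) : List ℕ := Denumerable.ofNat (List ℕ) a

open scoped Classical in
/-- The number which encodes the result of a program; it is `0` if the program does not halt. -/
noncomputable def evalOut (c : Code) (a : ℕ) : ℕ :=
  if h : (c.eval (listOf a)).Dom then Encodable.encode ((c.eval (listOf a)).get h) else 0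

/-- The intended value letters. -/
noncomputable def listVal : ValueLetter → ℕ → ℕ
  | .self, a => a
  | .zero, _ => 0
  | .succ, a => a + 1
  | .head, a => (listOf a).headI
  | .tail, a => Encodable.encode (listOf a).tail
  | .headSucc, a => (listOf a).headI + 1
  | .headPred, a => (listOf a).headI - 1
  | .predCons, a => Encodable.encode (((listOf a).headI - 1) :: (listOf a).tail)
  | .single, a => Encodable.encode [a]
  | .out c, a => evalOut c a
  | .outHead c, a => (listOf (evalOut c a)).headI
  | .outTail c, a => Encodable.encode (listOf (evalOut c a)).tail

/-- The intended flag letters. -/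
def listHolds : FlagLetter → ℕ → Prop
  | .isZero, a => a = 0
  | .isCons, a => a ≠ 0
  | .done c, a => (c.eval (listOf a)).Dom

/-- The intended structure. -/
noncomputable def listStructure : ValueStructure ValueLetter FlagLetter ℕ ℕ := ⟨listVal, listHolds⟩

@[simp] theorem listOf_encode (l : List ℕ) : listOf (Encodable.encode l) = l :=
  Denumerable.ofNat_encode l

@[simp] theorem encode_listOf (a : ℕ) : Encodable.encode (listOf a) = a :=
  Denumerable.encode_ofNat a

theorem listOf_zero : listOf 0 = [] := Denumerable.list_ofNat_zero

theorem evalOut_eq {c : Code} {a : ℕ} {r : List ℕ} (h : r ∈ c.eval (listOf a)) :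
    evalOut c a = Encodable.encode r := by
  obtain ⟨hd, rfl⟩ := h
  simp [evalOut, hd]

theorem listStructure_consOf {s t r : ValueLetter} {a b : ℕ}
    (h : listVal r a = Encodable.encode (listVal s a :: listOf (listVal t a))) :
    (consOf s t r).Realize listStructure a b := by
  refine ⟨Encodable.encode (listVal s a :: listOf (listVal t a)), ⟨?_, h⟩, ?_, ?_⟩
  · simp [PosEx.Realize, listStructure, listHolds]
  · simp only [PosEx.Realize, listStructure, listVal, listOf_encode, cond_true, cond_false,
      List.headI]
  · simp only [PosEx.Realize, listStructure, listVal, listOf_encode, cond_true, cond_false,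
      List.tail_cons, encode_listOf]

theorem listStructure_models_base : listStructure.Models baseClauses := by
  simp only [ValueStructure.Models, baseClauses, List.forall_mem_cons]
  refine ⟨fun _ _ _ => ⟨0, rfl⟩, fun a b h => Eq.symm h, ?_, ?_, fun a _ _ => ⟨a + 1, rfl⟩, ?_, ?_,
    fun a b _ => listStructure_consOf ?_, fun a b _ => listStructure_consOf ?_, ?_⟩
  · intro a b h
    replace h : a = 0 := h
    subst h
    have h₁ : listVal .head 0 = 0 := by simp [listVal, listOf_zero]
    have h₂ : listVal .tail 0 = 0 := by simp [listVal, listOf_zero]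
    exact ⟨h₁, h₂⟩
  · intro a b h
    replace h : a = b := h
    subst h
    exact ⟨rfl, rfl⟩
  · intro a b h
    exact congrArg (· + 1) h
  · intro a b h
    exact congrArg (· - 1) h
  · simp only [listVal, listOf_encode]
  · simp only [listVal, listOf_zero]
  · simp

/-- Determinism of programs makes the clauses true in the intended structure. -/
theorem listStructure_models_code (c : Code) : listStructure.Models (codeClauses c) := by
  have hres : ∀ {c d : Code} {a b : ℕ}, (d.eval (listOf b)).Dom →
      c.eval (listOf a) = d.eval (listOf b) → (resultXY c d).Realize listStructure a b := by
    intro c d a b hd h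
    refine ⟨?_, ?_⟩
    · simpa only [PosEx.Realize, listStructure, listHolds, cond_false, h] using hd
    · obtain ⟨r, hr⟩ := Part.dom_iff_mem.1 hd
      exact (evalOut_eq (h ▸ hr)).trans (evalOut_eq hr).symm
  have hcons : ∀ {c : Code} {s t : ValueLetter} {a b : ℕ},
      listVal s a :: listOf (listVal t a) ∈ c.eval (listOf a) →
      (PosEx.and (.flag (.done c) false) (consOf s t (.out c))).Realize listStructure a b :=
    fun h => ⟨Part.dom_iff_mem.2 ⟨_, h⟩, listStructure_consOf (evalOut_eq h)⟩
  induction c with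
  | zero' =>
    simp only [ValueStructure.Models, codeClauses, List.forall_mem_singleton]
    exact fun a b _ => hcons (by simp [listVal])
  | succ =>
    simp only [ValueStructure.Models, codeClauses, List.forall_mem_singleton]
    exact fun a b _ => hcons (by simp [listVal, listOf_zero])
  | tail =>
    simp only [ValueStructure.Models, codeClauses, List.forall_mem_singleton]
    refine fun a b _ => ⟨?_, ?_⟩
    · simp [PosEx.Realize, listStructure, listHolds]
    · exact evalOut_eq (by simp)
  | cons f fs ihf ihfs =>
    rw [codeClauses, models_append, models_append]
    refine ⟨⟨ihf, ihfs⟩, ?_⟩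
    simp only [ValueStructure.Models, List.forall_mem_cons]
    refine ⟨?_, fun a b h => hcons ?_, by simp⟩
    · intro a b h
      exact congrArg (fun z => (listOf z).headI) h
    · obtain ⟨r₁, h₁⟩ := Part.dom_iff_mem.1 h.1
      obtain ⟨r₂, h₂⟩ := Part.dom_iff_mem.1 h.2
      simp only [cond_false] at h₁ h₂
      simp only [listVal, evalOut_eq h₁, evalOut_eq h₂, listOf_encode,
        Code.cons_eval, Part.bind_eq_bind, Part.mem_bind_iff, Part.pure_eq_some, Part.mem_some_iff]
      exact ⟨r₁, h₁, r₂, h₂, rfl⟩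
  | comp f g ihf ihg =>
    rw [codeClauses, models_append, models_append]
    refine ⟨⟨ihf, ihg⟩, ?_⟩
    simp only [ValueStructure.Models, List.forall_mem_singleton]
    rintro a b ⟨hg, hf, h⟩
    refine hres hf ?_
    obtain ⟨r, hr⟩ := Part.dom_iff_mem.1 hg
    simp only [cond_false] at hr
    have hb : listOf b = r := by
      rw [← listOf_encode r, ← evalOut_eq hr]
      exact congrArg listOf (Eq.symm h)
    ext s
    simp only [mem_comp_eval, hb, Part.eq_some_iff.2 hr, Part.mem_some_iff, exists_eq_left]
  | case f g ihf ihg =>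
    rw [codeClauses, models_append, models_append]
    refine ⟨⟨ihf, ihg⟩, ?_⟩
    simp only [ValueStructure.Models, List.forall_mem_cons]
    refine ⟨?_, ?_, by simp⟩
    · rintro a b ⟨h0, hf, h⟩
      refine hres hf ?_
      have hb : listOf b = (listOf a).tail := by
        rw [← listOf_encode (listOf a).tail]
        exact congrArg listOf (Eq.symm h)
      replace h0 : (listOf a).headI = 0 := h0
      rw [Code.case_eval, hb]
      simp only [h0]
      rfl
    · rintro a b ⟨⟨n, hn⟩, hg, h⟩
      refine hres hg ?_
      have hb : listOf b = ((listOf a).headI - 1) :: (listOf a).tail := by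
        rw [← listOf_encode (_ :: _)]
        exact congrArg listOf (Eq.symm h)
      replace hn : (listOf a).headI = n + 1 := hn
      rw [Code.case_eval, hb]
      simp only [hn, Nat.add_sub_cancel]
  | fix f ih =>
    rw [codeClauses, models_append]
    refine ⟨ih, ?_⟩
    simp only [ValueStructure.Models, List.forall_mem_cons]
    refine ⟨?_, ?_, ?_, by simp⟩
    · intro a b h
      exact ⟨congrArg (fun z => (listOf z).headI) h,
        congrArg (fun z => Encodable.encode (listOf z).tail) h⟩
    · rintro a b ⟨hf, h0⟩
      obtain ⟨r, hr⟩ := Part.dom_iff_mem.1 hf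
      simp only [cond_false] at hr
      replace h0 : (listOf (evalOut f a)).headI = 0 := h0
      rw [evalOut_eq hr, listOf_encode] at h0
      have hmem : r.tail ∈ (Code.fix f).eval (listOf a) :=
        mem_fix_eval.2 ⟨r, hr, (if_pos h0).mpr rfl⟩
      refine ⟨Part.dom_iff_mem.2 ⟨_, hmem⟩, ?_⟩
      simp only [PosEx.Realize, listStructure, listVal, cond_false, evalOut_eq hmem,
        evalOut_eq hr, listOf_encode]
    · rintro a b ⟨⟨hf, n, hn⟩, hc, h⟩
      obtain ⟨r, hr⟩ := Part.dom_iff_mem.1 hf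
      simp only [cond_false] at hr
      replace hn : (listOf (evalOut f a)).headI = n + 1 := hn
      replace h : Encodable.encode (listOf (evalOut f a)).tail = b := h
      rw [evalOut_eq hr, listOf_encode] at hn h
      refine hres hc ?_
      subst h
      rw [listOf_encode]
      ext s
      have h0 : r.headI ≠ 0 := by omega
      rw [mem_fix_eval]
      simp only [Part.eq_some_iff.2 hr, Part.mem_some_iff, exists_eq_left, if_neg h0]

theorem realize_numeral (n a b : ℕ) : (numeral n).Realize listStructure a b ↔ a = n := by
  induction n generalizing a b with
  | zero => rfl
  | succ n ih =>
    simp only [numeral, PosEx.Realize, ih]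
    simp only [listStructure, listVal, cond_true, cond_false]
    constructor
    · rintro ⟨c, hc, d, hd, rfl⟩
      omega
    · rintro rfl
      exact ⟨n, rfl, n, rfl, rfl⟩

theorem not_haltsAt_of_not_dom {c : Code} {n : ℕ} (hn : ¬ (c.eval [n]).Dom) :
    ¬ ∃ a b, (haltsAt c n).Realize listStructure a b := by
  rintro ⟨a, b, ha, hb, hab⟩
  obtain rfl := (realize_numeral n a b).1 ha
  replace hab : Encodable.encode [a] = b := hab
  subst hab
  replace hb : (c.eval (listOf (Encodable.encode [a]))).Dom := hb
  rw [listOf_encode] at hb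
  exact hn hb

/-! ### The reduction -/

theorem exists_code_of_rePred {A : ℕ → Prop} (hA : REPred A) :
    ∃ c : Code, ∀ n, (c.eval [n]).Dom ↔ A n := by
  have hp : Partrec fun n : ℕ => (Part.assert (A n) fun _ => Part.some ()).map fun _ => (0 : ℕ) :=
    Partrec.map hA (Computable.const 0).to₂
  obtain ⟨c, hc⟩ := Code.exists_code (Nat.Partrec'.part_iff₁.2 hp)
  refine ⟨c, fun n => ?_⟩
  have h : c.eval [n] = _ := hc (n ::ᵥ List.Vector.nil)
  rw [h]
  simp [Part.map_eq_map, Part.assert]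

section Primrec

variable {α : Type} [Primcodable α] {f g : α → Formula}

theorem primrec_pair_code {f g : α → ℕ} (hf : Primrec f) (hg : Primrec g) (r : ℕ) :
    Primrec fun a => 6 * Nat.pair (f a) (g a) + r :=
  Primrec.nat_add.comp (Primrec.nat_mul.comp (Primrec.const 6) (Primrec₂.natPair.comp hf hg))
    (Primrec.const r)

theorem primrec_toCode (hf : Primrec f) : Primrec fun a => (f a).toCode :=
  (Primrec.of_equiv_iff Formula.equivNat).2 hf

theorem primrec_formula_of_toCode (hf : Primrec fun a => (f a).toCode) : Primrec f :=
  (Primrec.of_equiv_iff Formula.equivNat).1 hf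

theorem primrec_formula_and (hf : Primrec f) (hg : Primrec g) :
    Primrec fun a => Formula.and (f a) (g a) :=
  primrec_formula_of_toCode (primrec_pair_code (primrec_toCode hf) (primrec_toCode hg) 2)

theorem primrec_formula_or (hf : Primrec f) (hg : Primrec g) :
    Primrec fun a => Formula.or (f a) (g a) :=
  primrec_formula_of_toCode (primrec_pair_code (primrec_toCode hf) (primrec_toCode hg) 3)

theorem primrec_formula_imp (hf : Primrec f) (hg : Primrec g) :
    Primrec fun a => Formula.imp (f a) (g a) :=
  primrec_formula_of_toCode (primrec_pair_code (primrec_toCode hf) (primrec_toCode hg) 4)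

theorem primrec_formula_ex (x : ℕ) (hf : Primrec f) : Primrec fun a => Formula.ex x (f a) :=
  primrec_formula_of_toCode (primrec_pair_code (Primrec.const x) (primrec_toCode hf) 6)

end Primrec

theorem primrec_numeral : Primrec fun n => (numeral n).toFormula := by
  let step : Formula → Formula := fun φ => .ex 1 (.and (eqXY .self .succ).toFormula
    (.ex 0 (.and (eqXY .self .self).toFormula φ)))
  have hstep : Primrec₂ fun (_ : ℕ) φ => step φ :=
    primrec_formula_ex 1 (primrec_formula_and (Primrec.const _)
      (primrec_formula_ex 0 (primrec_formula_and (Primrec.const _) Primrec.snd)))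
  refine (Primrec.nat_rec₁ (numeral 0).toFormula hstep).of_eq fun n => ?_
  induction n with
  | zero => rfl
  | succ n ih => exact congrArg step ih

/-- The formula which is valid if and only if the program `c` halts at `[n]`. -/
noncomputable def haltFormula (c : Code) (n : ℕ) : Formula :=
  entailment (baseClauses ++ codeClauses c) (haltsAt c n)

theorem primrec_haltFormula (c : Code) : Primrec (haltFormula c) :=
  primrec_formula_imp (Primrec.const _) (primrec_formula_or
    (primrec_formula_ex 0 (primrec_formula_ex 1
      (primrec_formula_and primrec_numeral (Primrec.const _)))) (Primrec.const _))

theorem valid_haltFormula {c : Code} {n : ℕ} (h : (c.eval [n]).Dom) (A : AugFrame.{u, v}) :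
    A.Valid (haltFormula c n) :=
  valid_entailment _ _ A fun _ _ _ _ hS => exists_haltsAt c hS h

theorem haltFormula_notMem_QSILc {F : KripkeFrame.{u}} (htot : ∀ a b, F.R a b ∨ F.R b a)
    (e : ℕ → F.World) (he : ∀ m n, F.R (e m) (e n) ↔ m ≤ n) {c : Code} {n : ℕ}
    (h : ¬ (c.eval [n]).Dom) : haltFormula c n ∉ QSILc.{u, v} F :=
  entailment_notMem_QSILc e listStructure htot he _ _
    (models_append.2 ⟨listStructure_models_base, listStructure_models_code c⟩)
    (not_haltsAt_of_not_dom h)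

theorem QSILe_subset_QSILc (F : KripkeFrame.{u}) : QSILe.{u, v} F ⊆ QSILc.{u, v} F :=
  fun _ h A hA => h A hA.1

/-- The positive logics of a linear frame with a chain of type `ω` are hard. -/
theorem sigmaOneHard_of_chain (F : KripkeFrame.{u}) (htot : ∀ a b, F.R a b ∨ F.R b a)
    (e : ℕ → F.World) (he : ∀ m n, F.R (e m) (e n) ↔ m ≤ n) :
    SigmaOneHardInTwoVarLanguage (positiveFragment (QSILe.{u, v} F)) ∧
      SigmaOneHardInTwoVarLanguage (positiveFragment (QSILc.{u, v} F)) := by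
  have key : ∀ L : Set Formula, QSILe.{u, v} F ⊆ L → L ⊆ QSILc.{u, v} F →
      SigmaOneHardInTwoVarLanguage (positiveFragment L) := by
    intro L h₁ h₂ A hA
    obtain ⟨c, hc⟩ := exists_code_of_rePred hA
    refine ⟨haltFormula c, (primrec_haltFormula c).to_comp,
      fun n => inTwoVarLanguage_entailment _ _, fun n => ?_⟩
    rw [← hc n]
    constructor
    · exact fun h => ⟨h₁ fun A _ => valid_haltFormula h A, positive_entailment _ _⟩
    · intro h
      by_contra hn
      exact haltFormula_notMem_QSILc htot e he hn (h₂ h.1)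
  exact ⟨key _ subset_rfl (QSILe_subset_QSILc F), key _ (QSILe_subset_QSILc F) subset_rfl⟩

end IntPred

theorem mainTheorem9 :
    (IntPred.SigmaOneHardInTwoVarLanguage
        (IntPred.positiveFragment (IntPred.QSILe.{0, v} (IntPred.KripkeFrame.ofOrder ℤ))) ∧
      IntPred.SigmaOneHardInTwoVarLanguage
        (IntPred.positiveFragment (IntPred.QSILc.{0, v} (IntPred.KripkeFrame.ofOrder ℤ)))) ∧
    (IntPred.SigmaOneHardInTwoVarLanguage
        (IntPred.positiveFragment (IntPred.QSILe.{0, v} (IntPred.KripkeFrame.ofOrder ℝ))) ∧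
      IntPred.SigmaOneHardInTwoVarLanguage
        (IntPred.positiveFragment (IntPred.QSILc.{0, v} (IntPred.KripkeFrame.ofOrder ℝ)))) ∧
    ∀ (α : Ordinal.{u}) (hα : Ordinal.omega0 ≤ α),
      IntPred.SigmaOneHardInTwoVarLanguage
        (IntPred.positiveFragment (IntPred.QSILe.{u + 1, v}
          (IntPred.ordinalFrame α (Ordinal.omega0_pos.trans_le hα)))) ∧
      IntPred.SigmaOneHardInTwoVarLanguage
        (IntPred.positiveFragment (IntPred.QSILc.{u + 1, v}
          (IntPred.ordinalFrame α (Ordinal.omega0_pos.trans_le hα)))) := by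
  refine ⟨IntPred.sigmaOneHard_of_chain _ (fun a b : ℤ => le_total a b) (fun n => (n : ℤ))
      fun m n => Int.ofNat_le,
    IntPred.sigmaOneHard_of_chain _ (fun a b : ℝ => le_total a b) (fun n => (n : ℝ))
      fun m n => Nat.cast_le, fun α hα => ?_⟩
  exact IntPred.sigmaOneHard_of_chain _ (fun a b : Set.Iio α => le_total a b)
    (fun n => (⟨n, (Ordinal.natCast_lt_omega0 n).trans_le hα⟩ : Set.Iio α))
    fun m n => Nat.cast_le (α := Ordinal)
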